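/- For a group $\pi$ let $\Gamma^1\pi=\pi$, $\Gamma^{r+1}\pi=[\Gamma^r\pi,\pi]$ be its lower central series, and define the continuous cohomology of $\pi$ by $$H^\bullet_{\mathrm{cts}}(\pi,\mathbb{Q})=\varinjlim_r H^\bullet(\pi/\Gamma^r\pi,\mathbb{Q}),$$ where $H^\bullet(-,\mathbb{Q})$ is group cohomology with trivial rational coefficients and the transition maps are induced by the projections $\pi/\Gamma^{s}\pi\to\pi/\Gamma^{r}\pi$, $r\le s$. Let $R$ be $\mathbb{Z}[t]$ or $\mathbb{Z}[t,t^{-1}]$, and let $K(R)$ be the kernel of the homomorphism $SL_n(R)\to SL_n(\mathbb{Z})$ induced by $t\mapsto 0$ if $R=\mathbb{Z}[t]$, and by $t\mapsto 1$ if $R=\mathbb{Z}[t,t^{-1}]$. **Proposition.** If $n\ge 3$, then for both choices of $R$ $$\dim_{\mathbb{Q}} H^2_{\mathrm{cts}}(K(R),\mathbb{Q})\ \ge\ \frac{(n^2-1)^2}{4}.$$ -/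

import Mathlib

open CategoryTheory

/-- The group `K(R)`, for a commutative ring `R` with an augmentation `ε : R → ℤ`: the kernel of the
homomorphism `SL_n(R) → SL_n(ℤ)` that applies `ε` to every matrix entry. -/
abbrev congruenceKernel {R : Type} [CommRing R] (ε : R →+* ℤ) (n : ℕ) :
    Subgroup (Matrix.SpecialLinearGroup (Fin n) R) :=
  (Matrix.SpecialLinearGroup.map (n := Fin n) ε).ker

/-- The augmentation `ℤ[t] → ℤ`, `t ↦ 0`. -/
noncomputable def polyAug : Polynomial ℤ →+* ℤ :=
  Polynomial.evalRingHom 0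

/-- The augmentation `ℤ[t, t⁻¹] → ℤ`, `t ↦ 1`. -/
noncomputable def laurentAug : LaurentPolynomial ℤ →+* ℤ :=
  LaurentPolynomial.eval₂ (RingHom.id ℤ) (1 : ℤˣ)

namespace CtsCohomology

variable (π : Type) [Group π]

/-- The `r`-th term of the lower central series of `π`, counted from `r = 0`:
`lcs π 0 = π` and `lcs π (r + 1) = [lcs π r, π]`. -/
abbrev lcs (r : ℕ) : Subgroup π := (⊤ : Subgroup π).lowerCentralSeries r

/-- The nilpotent quotient of `π` by the `r`-th term of its lower central series. -/
abbrev NilQuot (r : ℕ) : Type := π ⧸ lcs π r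

/-- The projection from the quotient by the `s`-th term of the lower central series to the
quotient by the `r`-th term, for `r ≤ s`. -/
def proj (r s : ℕ) (h : r ≤ s) : NilQuot π s →* NilQuot π r :=
  QuotientGroup.map (lcs π s) (lcs π r) (MonoidHom.id π)
    ((⊤ : Subgroup π).lowerCentralSeries_antitone h)

/-- `H^k(G, ℚ)`: group cohomology with trivial rational coefficients. -/
noncomputable abbrev HQ (G : Type) [Group G] (k : ℕ) : ModuleCat ℚ :=
  groupCohomology (Rep.trivial ℚ G ℚ) k

/-- The map `H^k(H, ℚ) → H^k(G, ℚ)` induced by a group homomorphism `G → H`. -/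
noncomputable def pullback {G H : Type} [Group G] [Group H] (f : G →* H) (k : ℕ) :
    HQ H k →ₗ[ℚ] HQ G k :=
  (groupCohomology.map (A := Rep.trivial ℚ H ℚ) (B := Rep.trivial ℚ G ℚ) f
    (𝟙 (Rep.trivial ℚ G ℚ)) k).hom

/-- The transition map (inflation) from the `r`-th to the `s`-th nilpotent quotient, `r ≤ s`. -/
noncomputable def transition (k r s : ℕ) (h : r ≤ s) :
    HQ (NilQuot π r) k →ₗ[ℚ] HQ (NilQuot π s) k :=
  pullback (proj π r s h) k

theorem pullback_id (G : Type) [Group G] (k : ℕ) (x : HQ G k) :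
    pullback (MonoidHom.id G) k x = x := by
  have h := groupCohomology.map_id (B := Rep.trivial ℚ G ℚ) (n := k)
  exact congrArg (fun m => m.hom x) h

theorem pullback_comp {G H L : Type} [Group G] [Group H] [Group L] (f : H →* L) (g : G →* H)
    (k : ℕ) (x : HQ L k) : pullback (f.comp g) k x = pullback g k (pullback f k x) := by
  have h := groupCohomology.map_comp (A := Rep.trivial ℚ L ℚ) (B := Rep.trivial ℚ H ℚ)
    (C := Rep.trivial ℚ G ℚ) f g (𝟙 (Rep.trivial ℚ H ℚ)) (𝟙 (Rep.trivial ℚ G ℚ)) k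
  exact congrArg (fun m => m.hom x) h

theorem proj_self (r : ℕ) : proj π r r le_rfl = MonoidHom.id _ := by
  ext x; rfl

theorem proj_comp {r s t : ℕ} (h : r ≤ s) (h' : s ≤ t) :
    (proj π r s h).comp (proj π s t h') = proj π r t (h.trans h') := by
  ext x; rfl

instance directedSystem (k : ℕ) :
    DirectedSystem (fun r => HQ (NilQuot π r) k) (fun r s h => transition π k r s h) where
  map_self r x := by
    change pullback (proj π r r le_rfl) k x = x
    rw [proj_self, pullback_id]
  map_map r s t h h' x := by
    change pullback (proj π s r h') k (pullback (proj π t s h) k x) =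
      pullback (proj π t r (h.trans h')) k x
    rw [← pullback_comp, proj_comp]

end CtsCohomology

/-- The continuous cohomology `H^k_cts(π, ℚ)` of a (discrete) group `π`: the direct limit over `r`
of the rational cohomology groups of the quotients of `π` by the terms of its lower central
series. -/
abbrev HCts (π : Type) [Group π] (k : ℕ) : Type :=
  Module.DirectLimit (R := ℚ) (fun r => CtsCohomology.HQ (CtsCohomology.NilQuot π r) k)
    (CtsCohomology.transition π k)

/-! The linear term of an element of `K(R)` gives rational characters indexed by matrix entries.
Their cup products already live on the abelianization, hence define continuous classes. A linear
relation among them survives in the discrete group, where it says that a rational alternating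
bilinear form in the linear terms vanishes on all commuting pairs (`sum_cup_eq_zero`).

Commuting pairs come from `1 + u v fᵀ` and `1 + u w gᵀ` when all four pairings of `f`, `g` with `v`,
`w` vanish. Forms `φ([X, Y])` vanish on such pairs too, so not all cup products can be separated
this way. The families `rootPairs` and `rootTorusPairs` omit enough pairs of entries to exclude
these forms; `coeff_eq_zero_of_rank_one` shows that no other form survives either, and a count gives
the bound. -/

namespace CtsCohomology

/-! ### Cup products of characters and commuting pairs -/

section Cup

variable {G H : Type} [Group G] [Group H]

/-- The cup product cocycle of two rational characters of a group. -/
def cupCocycle (a b : G →* Multiplicative ℚ) :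
    groupCohomology.cocycles₂ (Rep.trivial ℚ G ℚ) :=
  ⟨fun p => (a p.1).toAdd * (b p.2).toAdd, by
    rw [groupCohomology.mem_cocycles₂_iff]
    intro g h j
    change ((a (g * h)).toAdd * (b j).toAdd + (a g).toAdd * (b h).toAdd : ℚ) =
      (a h).toAdd * (b j).toAdd + (a g).toAdd * (b (h * j)).toAdd
    simp only [map_mul, toAdd_mul]
    ring⟩

/-- The cup product in `H²(G, ℚ)` of two rational characters. -/
noncomputable def cup (a b : G →* Multiplicative ℚ) : HQ G 2 :=
  groupCohomology.H2π _ (cupCocycle a b)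

theorem pullback_cup (f : G →* H) (a b : H →* Multiplicative ℚ) :
    pullback f 2 (cup a b) = cup (a.comp f) (b.comp f) := by
  have h := groupCohomology.H2π_comp_map (A := Rep.trivial ℚ H ℚ) (B := Rep.trivial ℚ G ℚ) f
    (𝟙 (Rep.trivial ℚ G ℚ))
  exact congrArg (fun m => m.hom (cupCocycle a b)) h

/-- A rational 2-coboundary is symmetric on commuting pairs, which detects cup products. -/
theorem sum_cup_eq_zero {ι : Type} (s : Finset ι) (c : ι → ℚ) (a b : ι → G →* Multiplicative ℚ)
    (h : ∑ i ∈ s, c i • cup (a i) (b i) = 0) {x y : G} (hxy : x * y = y * x) :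
    ∑ i ∈ s, c i * ((a i x).toAdd * (b i y).toAdd - (a i y).toAdd * (b i x).toAdd) = 0 := by
  have h1 : groupCohomology.H2π (Rep.trivial ℚ G ℚ)
      (∑ i ∈ s, c i • cupCocycle (a i) (b i)) = 0 := by
    rw [← h, map_sum]
    simp only [map_smul]
    rfl
  rw [groupCohomology.H2π_eq_zero_iff] at h1
  obtain ⟨φ, hφ⟩ := h1
  have key (g k : G) : ∑ i ∈ s, c i * ((a i g).toAdd * (b i k).toAdd) =
      (φ k - φ (g * k) + φ g : ℚ) := by
    have h2 := congrFun hφ (g, k)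
    rw [groupCohomology.d₁₂_hom_apply] at h2
    have h3 : (∑ i ∈ s, c i • cupCocycle (a i) (b i)).1 (g, k) =
        ∑ i ∈ s, c i * ((a i g).toAdd * (b i k).toAdd) := by
      have : (∑ i ∈ s, c i • cupCocycle (a i) (b i)).1 =
          ∑ i ∈ s, c i • (cupCocycle (a i) (b i)).1 := by
        rw [AddSubmonoidClass.coe_finsetSum]; rfl
      rw [this, Finset.sum_apply]
      rfl
    exact h3.symm.trans h2.symm
  simp only [mul_sub, Finset.sum_sub_distrib, key, hxy]
  ring

end Cup

/-! ### Cup products in the direct limit -/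

section Limit

variable (π : Type) [Group π]

/-- The comparison map from continuous cohomology to the cohomology of the discrete group. -/
noncomputable def toDiscrete (k : ℕ) : HCts π k →ₗ[ℚ] HQ π k :=
  Module.DirectLimit.lift ℚ ℕ _ _ (fun r => pullback (QuotientGroup.mk' (lcs π r)) k)
    (fun r s h x => by
      change pullback _ k (pullback (proj π r s h) k x) = _
      rw [← pullback_comp]
      rfl)

variable {π}

/-- A rational character factors through the abelianization. -/
def descend (a : π →* Multiplicative ℚ) : NilQuot π 1 →* Multiplicative ℚ :=
  QuotientGroup.lift (lcs π 1) a (by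
    rw [lcs, Subgroup.top_lowerCentralSeries_one]
    exact Abelianization.commutator_subset_ker a)

/-- The cup product in continuous cohomology of two rational characters. -/
noncomputable def ctsCup (a b : π →* Multiplicative ℚ) : HCts π 2 :=
  -- The series is indexed from 0, so stage 1 is the abelianization.
  Module.DirectLimit.of ℚ ℕ _ _ 1 (cup (descend a) (descend b))

theorem toDiscrete_ctsCup (a b : π →* Multiplicative ℚ) :
    toDiscrete π 2 (ctsCup a b) = cup a b := by
  rw [toDiscrete, ctsCup, Module.DirectLimit.lift_of, pullback_cup]
  rfl

/-- A family of cup products is linearly independent in continuous cohomology as soon as its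
linear relations are excluded by evaluation on commuting pairs. -/
theorem card_le_rank_of_commuting {ι : Type} (s : Finset ι) (a b : ι → π →* Multiplicative ℚ)
    (h : ∀ c : ι → ℚ, (∀ x y : π, x * y = y * x →
      ∑ i ∈ s, c i * ((a i x).toAdd * (b i y).toAdd - (a i y).toAdd * (b i x).toAdd) = 0) →
      ∀ i ∈ s, c i = 0) :
    (s.card : Cardinal) ≤ Module.rank ℚ (HCts π 2) := by
  have hli : LinearIndepOn ℚ (fun i => ctsCup (a i) (b i)) (s : Set ι) := by
    rw [linearIndepOn_finset_iff]
    intro c hc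
    refine h c fun x y hxy => sum_cup_eq_zero s c a b ?_ hxy
    have := congrArg (toDiscrete π 2) hc
    simpa only [map_sum, map_smul, toDiscrete_ctsCup, map_zero] using this
  have := hli.linearIndependent.cardinal_le_rank
  simpa using this

end Limit

end CtsCohomology

/-! ### Forms vanishing on commuting rank one pairs -/

open Matrix in
/-- Relations satisfied by an alternating integral form on matrices that vanishes on the commuting
pairs of square-zero rank one matrices. -/
theorem form_eq_zero_of_rank_one {m : Type} [DecidableEq m] [Fintype m]
    (W : Matrix m m ℤ →+ Matrix m m ℤ →+ ℚ)
    (hW : ∀ v f w g : m → ℤ, f ⬝ᵥ v = 0 → g ⬝ᵥ w = 0 → f ⬝ᵥ w = 0 → g ⬝ᵥ v = 0 →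
      W (vecMulVec v f) (vecMulVec w g) = 0) :
    (∀ i j k l : m, i ≠ j → k ≠ l → j ≠ k → i ≠ l → W (single i j 1) (single k l 1) = 0) ∧
    (∀ i j k : m, i ≠ j → k ≠ i → k ≠ j →
      W (single i j 1) (single i i 1) - W (single i j 1) (single k k 1) =
        W (single k j 1) (single i k 1)) ∧
    (∀ i j k : m, i ≠ j → k ≠ i → k ≠ j →
      W (single i j 1) (single j j 1) - W (single i j 1) (single k k 1) =
        W (single i k 1) (single k j 1)) := by
  have comm : ∀ i j k l : m, i ≠ j → k ≠ l → j ≠ k → i ≠ l →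
      W (single i j 1) (single k l 1) = 0 := by
    intro i j k l hij hkl hjk hil
    have := hW (Pi.single i 1) (Pi.single j 1) (Pi.single k 1) (Pi.single l 1)
    simpa [single_eq_single_vecMulVec_single, hij, hkl, hjk, hil, hij.symm, hkl.symm, hjk.symm,
      hil.symm] using this
  refine ⟨comm, fun i j k hij hki hkj => ?_, fun i j k hij hki hkj => ?_⟩
  -- The pair in `h2` is this one with `e_k` replaced by `-e_k`. Adding the two leaves only the
  -- terms even in `e_k`, one of which vanishes by `h3`.
  · have h1 : W (vecMulVec (Pi.single i 1 + Pi.single k 1) (Pi.single j 1))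
        (vecMulVec (Pi.single i 1 + Pi.single k 1) (Pi.single i 1 - Pi.single k 1)) = 0 := by
      apply hW <;> simp [hij, hki, hki.symm, hkj.symm]
    have h2 : W (vecMulVec (Pi.single i 1 - Pi.single k 1) (Pi.single j 1))
        (vecMulVec (Pi.single i 1 - Pi.single k 1) (Pi.single i 1 + Pi.single k 1)) = 0 := by
      apply hW <;> simp [hij, hki, hki.symm, hkj.symm]
    have h3 := comm k j k i hkj hki hkj.symm hki
    simp only [add_vecMulVec, sub_vecMulVec, vecMulVec_add, vecMulVec_sub,
      ← single_eq_single_vecMulVec_single, map_add, map_sub, AddMonoidHom.add_apply,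
      AddMonoidHom.sub_apply] at h1 h2
    linarith
  · have h1 : W (vecMulVec (Pi.single i 1) (Pi.single j 1 + Pi.single k 1))
        (vecMulVec (Pi.single j 1 - Pi.single k 1) (Pi.single j 1 + Pi.single k 1)) = 0 := by
      apply hW <;> simp [hij, hki.symm, hkj, hkj.symm]
    have h2 : W (vecMulVec (Pi.single i 1) (Pi.single j 1 - Pi.single k 1))
        (vecMulVec (Pi.single j 1 + Pi.single k 1) (Pi.single j 1 - Pi.single k 1)) = 0 := by
      apply hW <;> simp [hij, hki.symm, hkj, hkj.symm]
    have h3 := comm i k j k hki.symm hkj.symm hkj hki.symm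
    simp only [add_vecMulVec, sub_vecMulVec, vecMulVec_add, vecMulVec_sub,
      ← single_eq_single_vecMulVec_single, map_add, map_sub, AddMonoidHom.add_apply,
      AddMonoidHom.sub_apply] at h1 h2
    linarith

/-! ### Counting the chosen pairs -/

/-- Pairs of distinct roots `(p, q)` of `sl_n`, in lexicographic order and not opposite. -/
def rootPairs (n : ℕ) : Finset ((Fin n × Fin n) × (Fin n × Fin n)) :=
  {τ | τ.1.1 ≠ τ.1.2 ∧ τ.2.1 ≠ τ.2.2 ∧ τ.2 ≠ τ.1.swap ∧ toLex τ.1 < toLex τ.2}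

/-- Pairs of a root `(i, j)` and a diagonal index `(k, k)` with `k ≠ i, j`. -/
def rootTorusPairs (n : ℕ) : Finset ((Fin n × Fin n) × (Fin n × Fin n)) :=
  {τ | τ.1.1 ≠ τ.1.2 ∧ τ.2.1 = τ.2.2 ∧ τ.2.1 ≠ τ.1.1 ∧ τ.2.1 ≠ τ.1.2}

theorem card_roots (n : ℕ) : (Finset.univ : Finset (Fin n)).offDiag.card = n * (n - 1) := by
  rw [Finset.offDiag_card, Finset.card_univ, Fintype.card_fin, Nat.mul_sub, mul_one]

theorem two_mul_card_rootPairs (n : ℕ) :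
    2 * (rootPairs n).card = n * (n - 1) * (n * (n - 1) - 2) := by
  set R := (Finset.univ : Finset (Fin n)).offDiag with hR
  have hmem (p : Fin n × Fin n) : p ∈ R ↔ p.1 ≠ p.2 := by simp [hR]
  have hswap : (rootPairs n).card = ((rootPairs n).image Prod.swap).card :=
    (Finset.card_image_of_injective _ Prod.swap_injective).symm
  have hdisj : Disjoint (rootPairs n) ((rootPairs n).image Prod.swap) := by
    rw [Finset.disjoint_left]
    intro τ h1 h2
    obtain ⟨σ, h3, rfl⟩ := Finset.mem_image.1 h2
    simp only [rootPairs, Finset.mem_filter, Finset.mem_univ, true_and, Prod.fst_swap,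
      Prod.snd_swap] at h1 h3
    exact lt_asymm h1.2.2.2 h3.2.2.2
  -- Together with its swap, the set gives all ordered pairs of roots that are neither equal nor
  -- opposite.
  have hunion : rootPairs n ∪ (rootPairs n).image Prod.swap =
      (R ×ˢ R).filter (fun τ => τ.2 ∉ ({τ.1, τ.1.swap} : Finset _)) := by
    ext ⟨p, q⟩
    have hsw : p = q.swap ↔ q = p.swap := by
      constructor <;> rintro rfl <;> simp
    have hlt : toLex p < toLex q ∨ toLex q < toLex p ↔ q ≠ p := by
      rw [lt_or_lt_iff_ne, ne_comm]; simp
    have himg : (p, q) ∈ (rootPairs n).image Prod.swap ↔ (q, p) ∈ rootPairs n := by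
      rw [Finset.mem_image]
      exact ⟨by rintro ⟨σ, h, h'⟩; rw [← Prod.swap_swap σ, h'] at h; exact h, fun h => ⟨_, h, rfl⟩⟩
    rw [Finset.mem_union, himg]
    simp only [rootPairs, Finset.mem_filter, Finset.mem_univ, true_and, Finset.mem_product, hmem,
      Finset.mem_insert, Finset.mem_singleton, not_or, ← hlt, ne_eq, hsw]
    tauto
  have hcard : ((R ×ˢ R).filter (fun τ => τ.2 ∉ ({τ.1, τ.1.swap} : Finset _))).card =
      ∑ p ∈ R, (R.card - 2) := by
    rw [Finset.card_filter, Finset.sum_product]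
    refine Finset.sum_congr rfl fun p hp => ?_
    rw [← Finset.card_filter]
    dsimp only
    rw [Finset.filter_notMem_eq_sdiff, Finset.card_sdiff_of_subset, Finset.card_pair]
    · intro h
      exact (hmem p).1 hp (congrArg Prod.fst h)
    · intro q hq
      rw [Finset.mem_insert, Finset.mem_singleton] at hq
      rw [hmem] at hp ⊢
      rcases hq with rfl | rfl
      · exact hp
      · exact hp.symm
  rw [← hunion, Finset.card_union_of_disjoint hdisj, ← hswap, Finset.sum_const, smul_eq_mul, hR,
    card_roots] at hcard
  omega

theorem card_rootTorusPairs (n : ℕ) : (rootTorusPairs n).card = n * (n - 1) * (n - 2) := by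
  set R := (Finset.univ : Finset (Fin n)).offDiag with hR
  have hmem (p : Fin n × Fin n) : p ∈ R ↔ p.1 ≠ p.2 := by simp [hR]
  have hcard : (rootTorusPairs n).card =
      ((R ×ˢ Finset.univ).filter (fun τ => τ.2 ∉ ({τ.1.1, τ.1.2} : Finset (Fin n)))).card := by
    refine Finset.card_nbij' (fun τ => (τ.1, τ.2.1)) (fun τ => (τ.1, (τ.2, τ.2))) ?_ ?_ ?_ ?_
    · rintro ⟨p, q⟩
      simp [rootTorusPairs, hmem]
      tauto
    · rintro ⟨p, k⟩
      simp [rootTorusPairs, hmem]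
    · rintro ⟨p, q⟩
      simp only [rootTorusPairs, Finset.coe_filter, Finset.mem_univ, true_and, Set.mem_ofPred_eq]
      rintro ⟨-, h, -⟩
      simp [Prod.ext_iff, h]
    · rintro ⟨p, k⟩ _
      rfl
  rw [hcard, Finset.card_filter, Finset.sum_product, ← card_roots, Finset.card_eq_sum_ones,
    Finset.sum_mul]
  refine Finset.sum_congr rfl fun p hp => ?_
  rw [← Finset.card_filter]
  dsimp only
  rw [Finset.filter_notMem_eq_sdiff,
    Finset.card_sdiff_of_subset (Finset.subset_univ _), Finset.card_pair ((hmem p).1 hp)]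
  simp

/-- Four times the count is `2n(n-1)(n-2)(n+3)`. The bound fails for `n = 2`, where the count is 0.
-/
theorem sq_le_four_mul_card {n : ℕ} (hn : 3 ≤ n) :
    (n ^ 2 - 1) ^ 2 ≤ 4 * (rootPairs n ∪ rootTorusPairs n).card := by
  have hdisj : Disjoint (rootPairs n) (rootTorusPairs n) := by
    rw [Finset.disjoint_left]
    intro τ h1 h2
    simp only [rootPairs, rootTorusPairs, Finset.mem_filter] at h1 h2
    exact h1.2.2.1 h2.2.2.1
  rw [Finset.card_union_of_disjoint hdisj, card_rootTorusPairs]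
  have h := two_mul_card_rootPairs n
  obtain ⟨m, rfl⟩ := Nat.exists_eq_add_of_le hn
  have e1 : (3 + m) ^ 2 - 1 = m ^ 2 + 6 * m + 8 := by
    rw [Nat.sub_eq_iff_eq_add (Nat.one_le_pow _ _ (by omega))]; ring
  have e2 : (3 + m) * (3 + m - 1) - 2 = m ^ 2 + 5 * m + 4 := by
    rw [Nat.sub_eq_iff_eq_add]
    · rw [show 3 + m - 1 = m + 2 by omega]; ring
    · rw [show 3 + m - 1 = m + 2 by omega]; nlinarith
  rw [e2, show 3 + m - 1 = m + 2 by omega] at h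
  rw [e1, show 3 + m - 1 = m + 2 by omega, show 3 + m - 2 = m + 1 by omega, mul_add,
    show 4 * (rootPairs (3 + m)).card = 2 * (2 * (rootPairs (3 + m)).card) by ring, h]
  ring_nf
  nlinarith [Nat.zero_le m, Nat.zero_le (m ^ 2), Nat.zero_le (m ^ 3), Nat.zero_le (m ^ 4)]

/-! ### Vanishing of the coefficients -/

/-- The coefficients of an alternating form supported on `rootPairs` and `rootTorusPairs` that
vanishes on commuting pairs of square-zero rank one matrices are zero. -/
theorem coeff_eq_zero_of_rank_one {n : ℕ} (c : (Fin n × Fin n) × (Fin n × Fin n) → ℚ)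
    (hc : ∀ v f w g : Fin n → ℤ, f ⬝ᵥ v = 0 → g ⬝ᵥ w = 0 → f ⬝ᵥ w = 0 → g ⬝ᵥ v = 0 →
      ∑ τ ∈ rootPairs n ∪ rootTorusPairs n,
        c τ * (((v τ.1.1 * f τ.1.2 : ℤ) : ℚ) * ((w τ.2.1 * g τ.2.2 : ℤ) : ℚ) -
          ((w τ.1.1 * g τ.1.2 : ℤ) : ℚ) * ((v τ.2.1 * f τ.2.2 : ℤ) : ℚ)) = 0) :
    ∀ τ ∈ rootPairs n ∪ rootTorusPairs n, c τ = 0 := by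
  set S := rootPairs n ∪ rootTorusPairs n with hS
  let W : Matrix (Fin n) (Fin n) ℤ →+ Matrix (Fin n) (Fin n) ℤ →+ ℚ :=
    AddMonoidHom.mk' (fun X => AddMonoidHom.mk' (fun Y => ∑ τ ∈ S, c τ *
        ((X τ.1.1 τ.1.2 : ℚ) * (Y τ.2.1 τ.2.2 : ℚ) - (Y τ.1.1 τ.1.2 : ℚ) * (X τ.2.1 τ.2.2 : ℚ)))
      (fun Y Z => by
        rw [← Finset.sum_add_distrib]
        refine Finset.sum_congr rfl fun τ _ => ?_
        push_cast [Matrix.add_apply]; ring))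
      (fun X Z => by
        ext Y
        simp only [AddMonoidHom.mk'_apply, AddMonoidHom.add_apply]
        rw [← Finset.sum_add_distrib]
        refine Finset.sum_congr rfl fun τ _ => ?_
        push_cast [Matrix.add_apply]; ring)
  obtain ⟨h1, h2, h3⟩ := form_eq_zero_of_rank_one W hc
  have hval (i j k l : Fin n) : W (Matrix.single i j 1) (Matrix.single k l 1) =
      (if ((i, j), (k, l)) ∈ S then c ((i, j), (k, l)) else 0) -
        (if ((k, l), (i, j)) ∈ S then c ((k, l), (i, j)) else 0) := by
    have aux (p q : Fin n × Fin n) : ∑ τ ∈ S, c τ *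
        (((Matrix.single p.1 p.2 (1 : ℤ) τ.1.1 τ.1.2 : ℤ) : ℚ) *
          ((Matrix.single q.1 q.2 (1 : ℤ) τ.2.1 τ.2.2 : ℤ) : ℚ)) =
        if (p, q) ∈ S then c (p, q) else 0 := by
      rw [← Finset.sum_ite_eq' S (p, q) c]
      refine Finset.sum_congr rfl fun τ _ => ?_
      simp only [Matrix.single_apply, Prod.ext_iff]
      push_cast
      rw [ite_zero_mul_ite_zero, mul_ite, mul_one, mul_one, mul_zero]
      refine if_congr ?_ rfl rfl
      simp only [eq_comm]
    rw [← aux (i, j) (k, l), ← aux (k, l) (i, j), ← Finset.sum_sub_distrib]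
    refine Finset.sum_congr rfl fun τ _ => ?_
    rw [← mul_sub]
  have hmem (i j k l : Fin n) : ((i, j), (k, l)) ∈ S ↔
      (i ≠ j ∧ k ≠ l ∧ ¬ (k = j ∧ l = i) ∧ toLex (i, j) < toLex (k, l)) ∨
        (i ≠ j ∧ k = l ∧ k ≠ i ∧ k ≠ j) := by
    simp [hS, rootPairs, rootTorusPairs]
  have torus (i j k : Fin n) (hij : i ≠ j) (hki : k ≠ i) (hkj : k ≠ j) :
      c ((i, j), (k, k)) = 0 := by
    have e1 := h2 i j k hij hki hkj
    have e2 := h3 i j k hij hki hkj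
    have e3 : W (Matrix.single k j 1) (Matrix.single i k 1) =
      - W (Matrix.single i k 1) (Matrix.single k j 1) := by
      rw [hval, hval]; ring
    -- Antisymmetry turns the two relations into `W(E_ij, E_ii) + W(E_ij, E_jj) = 2 W(E_ij, E_kk)`;
    -- the left side is zero because those pairs lie outside `S`.
    rw [e3, ← e2] at e1
    simp only [hval, hmem] at e1
    simp [hij, hij.symm, hki, hkj] at e1
    linarith
  have chain (i j k : Fin n) (hij : i ≠ j) (hki : k ≠ i) (hkj : k ≠ j) :
      W (Matrix.single i k 1) (Matrix.single k j 1) = 0 := by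
    rw [← h3 i j k hij hki hkj]
    simp only [hval, hmem]
    simp [hij, hki, hkj, torus i j k hij hki hkj]
  rintro ⟨⟨i, j⟩, ⟨k, l⟩⟩ hτ
  -- At most one ordering of a pair lies in `S`, so `W` reads off a single coefficient.
  have hW : W (Matrix.single i j 1) (Matrix.single k l 1) = c ((i, j), (k, l)) := by
    rw [hval, if_pos hτ, if_neg, sub_zero]
    rw [hmem] at hτ ⊢
    rintro (⟨h, -, -, h'⟩ | ⟨h, h', -⟩) <;> rcases hτ with ⟨h4, -, -, h5⟩ | ⟨h4, h5, -⟩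
    · exact lt_asymm h' h5
    · exact h h5
    · exact h4 h'
    · exact h4 h'
  rcases (hmem i j k l).1 hτ with ⟨hij, hkl, hne, -⟩ | ⟨hij, rfl, hki, hkj⟩
  · rw [← hW]
    by_cases hjk : j = k
    · subst hjk
      exact chain i l j (fun h => hne ⟨rfl, h.symm⟩) hij.symm hkl
    · by_cases hil : i = l
      · subst hil
        have := chain k j i (fun h => hjk h.symm) hkl.symm hij
        rw [hval] at this ⊢
        linarith
      · exact h1 i j k l hij hkl hjk hil
  · exact torus i j k hij hki hkj

/-! ### Characters and commuting elements of `K(R)` -/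

section LinearTerm

open Matrix TrivSqZeroExt

variable {R : Type} [CommRing R] {ε : R →+* ℤ} {n : ℕ}

/-- The entries of the linear term `X` of `1 + uX + ⋯ ∈ K(R)`, as rational characters. The linear
term is read off after applying a ring homomorphism to the dual numbers that lifts `ε`. -/
noncomputable def linearEntry (Φ : R →+* DualNumber ℤ) (hΦ : ∀ a, (Φ a).fst = ε a)
    (p : Fin n × Fin n) : congruenceKernel ε n →* Multiplicative ℚ :=
  MonoidHom.mk' (fun g => Multiplicative.ofAdd (((Φ (g.1.1 p.1 p.2)).snd : ℤ) : ℚ)) (by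
    have one (g : congruenceKernel ε n) (i j : Fin n) :
        ε (g.1.1 i j) = (1 : Matrix (Fin n) (Fin n) ℤ) i j :=
      congrArg (fun A : Matrix.SpecialLinearGroup (Fin n) ℤ => A.1 i j) (MonoidHom.mem_ker.1 g.2)
    intro g h
    rw [← ofAdd_add, ← Int.cast_add]
    congr 2
    change (Φ ((g.1.1 * h.1.1) p.1 p.2)).snd = _
    rw [Matrix.mul_apply, map_sum, snd_sum]
    -- Additivity is the Leibniz rule: both factors reduce to the identity under `ε`.
    simp only [map_mul, DualNumber.snd_mul, hΦ, one, Finset.sum_add_distrib]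
    simp [Matrix.one_apply, add_comm])

theorem intCast_dotProduct_mul_intCast (u : R) {a b : Fin n → ℤ} (h : a ⬝ᵥ b = 0) :
    (fun j => (a j : R)) ⬝ᵥ (fun i => u * (b i : R)) = 0 := by
  have : (fun j => (a j : R)) ⬝ᵥ (fun i => u * (b i : R)) = u * ((a ⬝ᵥ b : ℤ) : R) := by
    simp only [dotProduct, Int.cast_sum, Int.cast_mul, Finset.mul_sum]
    exact Finset.sum_congr rfl fun _ _ => by ring
  rw [this, h, Int.cast_zero, mul_zero]

/-- The element `1 + u v fᵀ` of `K(R)`, for orthogonal integral vectors `v`, `f`. -/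
def rankOneElement (u : R) (hu : ε u = 0) (v f : Fin n → ℤ) (h : f ⬝ᵥ v = 0) :
    congruenceKernel ε n :=
  ⟨⟨1 + vecMulVec (fun i => u * (v i : R)) (fun j => (f j : R)), by
    rw [vecMulVec_eq Unit, det_one_add_replicateCol_mul_replicateRow,
      intCast_dotProduct_mul_intCast u h, add_zero]⟩, by
    refine MonoidHom.mem_ker.2 ?_
    ext i j
    change ε ((1 + vecMulVec (fun i => u * (v i : R)) (fun j => (f j : R)) : Matrix _ _ R) i j) =
      (1 : Matrix (Fin n) (Fin n) ℤ) i j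
    rw [Matrix.add_apply, vecMulVec_apply, map_add, map_mul, map_mul, hu, zero_mul, zero_mul,
      add_zero, Matrix.one_apply, Matrix.one_apply, apply_ite ε, map_one, map_zero]⟩

theorem linearEntry_rankOneElement (Φ : R →+* DualNumber ℤ) (hΦ : ∀ a, (Φ a).fst = ε a) {u : R}
    (hu : ε u = 0) (hu' : (Φ u).snd = 1) (v f : Fin n → ℤ) (h : f ⬝ᵥ v = 0)
    (p : Fin n × Fin n) :
    (linearEntry Φ hΦ p (rankOneElement u hu v f h)).toAdd = ((v p.1 * f p.2 : ℤ) : ℚ) := by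
  change (((Φ ((1 + vecMulVec (fun i => u * (v i : R)) (fun j => (f j : R)) : Matrix _ _ R)
    p.1 p.2)).snd : ℤ) : ℚ) = _
  congr 1
  have : (Φ ((1 : Matrix (Fin n) (Fin n) R) p.1 p.2)).snd = 0 := by
    rw [Matrix.one_apply]
    split_ifs <;> simp
  rw [Matrix.add_apply, map_add, snd_add, this, vecMulVec_apply]
  simp [hΦ, hu, hu']

/-- The cross terms carry the factors `f ⬝ᵥ w` and `g ⬝ᵥ v`, so both products of the rank one parts
vanish. -/
theorem rankOneElement_mul_comm {u : R} (hu : ε u = 0) {v f w g : Fin n → ℤ} (hfv : f ⬝ᵥ v = 0)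
    (hgw : g ⬝ᵥ w = 0) (hfw : f ⬝ᵥ w = 0) (hgv : g ⬝ᵥ v = 0) :
    rankOneElement u hu v f hfv * rankOneElement u hu w g hgw =
      rankOneElement u hu w g hgw * rankOneElement u hu v f hfv := by
  apply Subtype.ext
  apply Subtype.ext
  change (1 + vecMulVec (fun i => u * (v i : R)) (fun j => (f j : R)) : Matrix _ _ R) *
    (1 + vecMulVec (fun i => u * (w i : R)) (fun j => (g j : R))) =
    (1 + vecMulVec (fun i => u * (w i : R)) (fun j => (g j : R))) *
    (1 + vecMulVec (fun i => u * (v i : R)) (fun j => (f j : R)))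
  simp only [mul_add, add_mul, one_mul, mul_one, vecMulVec_mul_vecMulVec, intCast_dotProduct_mul_intCast u hfw,
    intCast_dotProduct_mul_intCast u hgv, zero_smul, vecMulVec_zero, add_zero]
  abel

/-- All that is needed from `R` is a first-order expansion `Φ` along `ε` and a parameter `u` with
linear term 1, which treats both rings at once. -/
theorem sq_le_four_mul_rank_HCts (Φ : R →+* DualNumber ℤ) (hΦ : ∀ a, (Φ a).fst = ε a) (u : R)
    (hu : ε u = 0) (hu' : (Φ u).snd = 1) (hn : 3 ≤ n) :
    (((n ^ 2 - 1) ^ 2 : ℕ) : Cardinal) ≤ 4 * Module.rank ℚ (HCts (congruenceKernel ε n) 2) := by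
  have h := CtsCohomology.card_le_rank_of_commuting (rootPairs n ∪ rootTorusPairs n)
    (fun τ => linearEntry Φ hΦ τ.1) (fun τ => linearEntry Φ hΦ τ.2) (fun c hc =>
      coeff_eq_zero_of_rank_one c fun v f w g hfv hgw hfw hgv => by
        have := hc _ _ (rankOneElement_mul_comm hu hfv hgw hfw hgv)
        simpa only [linearEntry_rankOneElement Φ hΦ hu hu'] using this)
  calc (((n ^ 2 - 1) ^ 2 : ℕ) : Cardinal)
      ≤ ((4 * (rootPairs n ∪ rootTorusPairs n).card : ℕ) : Cardinal) :=
        Nat.cast_le.2 (sq_le_four_mul_card hn)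
    _ = 4 * ((rootPairs n ∪ rootTorusPairs n).card : Cardinal) := by push_cast; rfl
    _ ≤ _ := mul_le_mul_right h 4

/-- The unit `1 + ε` of the dual numbers. -/
def oneAddEps : (DualNumber ℤ)ˣ where
  val := 1 + DualNumber.eps
  inv := 1 - DualNumber.eps
  val_inv := by ext <;> simp
  inv_val := by ext <;> simp

theorem fst_eval₂_oneAddEps (a : LaurentPolynomial ℤ) :
    (LaurentPolynomial.eval₂ (algebraMap ℤ (DualNumber ℤ)) oneAddEps a).fst = laurentAug a := by
  have : ((fstHom ℤ ℤ ℤ).toRingHom.comp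
      (LaurentPolynomial.eval₂ (algebraMap ℤ (DualNumber ℤ)) oneAddEps)) = laurentAug := by
    refine IsLocalization.ringHom_ext (Submonoid.powers (Polynomial.X : Polynomial ℤ)) ?_
    refine Polynomial.ringHom_ext (fun a => ?_) ?_
    · simp
    · simp [laurentAug, oneAddEps]
  exact DFunLike.congr_fun this a

end LinearTerm

theorem proposition5p3 (n : ℕ) (hn : 3 ≤ n) :
    (((n ^ 2 - 1) ^ 2 : ℕ) : Cardinal) ≤
        4 * Module.rank ℚ (HCts (congruenceKernel polyAug n) 2) ∧
      (((n ^ 2 - 1) ^ 2 : ℕ) : Cardinal) ≤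
        4 * Module.rank ℚ (HCts (congruenceKernel laurentAug n) 2) := by
  constructor
  · refine sq_le_four_mul_rank_HCts
      (Polynomial.eval₂RingHom (algebraMap ℤ (DualNumber ℤ)) DualNumber.eps) (fun a => ?_)
      Polynomial.X ?_ ?_ hn
    · have : ((TrivSqZeroExt.fstHom ℤ ℤ ℤ).toRingHom.comp
          (Polynomial.eval₂RingHom (algebraMap ℤ (DualNumber ℤ)) DualNumber.eps)) = polyAug := by
        refine Polynomial.ringHom_ext (fun a => ?_) ?_ <;> simp [polyAug]
      exact DFunLike.congr_fun this a
    · simp [polyAug]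
    · simp
  -- Expanding at `t = 1` sends `t` to `1 + eps`, with parameter `u = t - 1`.
  · refine sq_le_four_mul_rank_HCts
      (LaurentPolynomial.eval₂ (algebraMap ℤ (DualNumber ℤ)) oneAddEps) fst_eval₂_oneAddEps
      (LaurentPolynomial.T 1 - 1) ?_ ?_ hn
    · simp [laurentAug, LaurentPolynomial.eval₂_T]
    · simp [LaurentPolynomial.eval₂_T, oneAddEps]
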